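/- **Proof Hierarchy Theorem.** Fix a first-order language with equality that has finitely many symbols, among them a constant $0$ and a unary function symbol $S$. The numeral $\overline{n}$ is the term $S\cdots S0$ with $n$ letters $S$. Formulas, and finite lists of formulas and nested sub-proofs, are written as strings over a fixed finite alphabet. Formulas are in Polish notation with $\bot,=,\to,\forall$ as primitive logical symbols, and variable indices are in unary. A string is identified with the natural number that it writes in a fixed base, with each symbol a nonzero digit, and $|x|$ denotes the number of digits of $x\in\mathbb N$. A *theory* is a set $T$ of sentences closed under logical consequence, and it is *consistent* if it contains no sentence together with its negation. A *proof verifier* for $T$ is a function $V:\mathbb N^2\to\{\text{accept},\text{reject}\}$ such that for every $a\in\mathbb N$, $V(p,a)=\text{accept}$ for some $p\in\mathbb N$ if and only if $a$ is a sentence in $T$. The theory $T$ is *computably enumerable* if it has a computable proof verifier. The theory $T$ *represents* a function $f:\mathbb N^k\to\mathbb N$ if it contains the axioms $\forall x\,\neg Sx=0$, $\forall x\forall y\,(Sx=Sy\to x=y)$ and $\forall x\,(x=0\lor\exists y\,Sy=x)$, and there is a formula $F$ with $k+1$ free variables such that $(\exists!y\,F(\overline{x_1},\dots,\overline{x_k},y))\land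 F(\overline{x_1},\dots,\overline{x_k},\overline{f(x_1,\dots,x_k)})\in T$ for all $x_1,\dots,x_k\in\mathbb N$. A proof verifier $V$ for $T$ is *canonical* if, whenever $V(p,A)=\text{accept}$ for a number $p$ and a sentence $A$: 1. $p$ is a list, with $A$ among its items, each of whose items is a theorem of $T$ or a valid sub-proof. A sub-proof may introduce an arbitrary variable and a hypothesis. It is valid if every line in it, at any depth of nesting, is a consequence of $T$ and the hypotheses in force, and no arbitrary variable is free in a hypothesis already in force where that variable is introduced. 2. If a sentence $B$ follows from the items of $p$ by one application of a rule of natural deduction (repetition; introduction and elimination of $\land,\lor,\to,\forall,\exists$; ex falso; double negation elimination; reflexivity of equality and substitution of equals), then $V(p\frown[B],B)=\text{accept}$, where $p\frown[B]$ is the list $p$ extended by $B$. For a set $\mathcal A\subseteq T$ of sentences, its *proof complexity* with respect to $V$ is $$c_{\mathcal A}(n)=\max_{A\in\mathcal A,\ |A|\le n}\ \min\{|p| : p\in\mathbb N,\ V(p,A)=\text{accept or }V(p,\neg A)=\text{accept}\},$$ with the maximum over the empty set being $0$. Let $T$ be a consistent, computably enumerable theory that represents every (total) computable function. Let $g:\mathbb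 N\to\mathbb N$ be computable and monotone (nondecreasing) with $g(n)=\Omega(n)$, and let $f:\mathbb N\to\mathbb R$ satisfy $f(n+1)=o(g(n))$. Then for every computable canonical proof verifier $V$ for $T$ there is a set $\mathcal A\subseteq T$ such that $c_{\mathcal A}(n)=O(g(n))$ but $c_{\mathcal A}(n)$ is not $O(f(n))$. -/

import Mathlib

open FirstOrder FirstOrder.Language Filter Asymptotics

namespace ProofHierarchy

/-! ### Languages -/

/-- A finite first-order signature: the constant `0`, the unary function symbol `S`, and finitely
many further function and relation symbols, given by the lists of their arities.  The language of
arithmetic is `⟨[2, 2], []⟩`. -/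
structure Signature where
  funs : List ℕ
  rels : List ℕ

/-- Function symbols, sorted by arity. -/
inductive Func (σ : Signature) : ℕ → Type
  | zero : Func σ 0
  | succ : Func σ 1
  | extra (i : Fin σ.funs.length) : Func σ (σ.funs.get i)

/-- Relation symbols, sorted by arity (equality is a logical symbol). -/
inductive Rel (σ : Signature) : ℕ → Type
  | extra (i : Fin σ.rels.length) : Rel σ (σ.rels.get i)

/-- The first-order language with equality of a signature. -/
def lang (σ : Signature) : FirstOrder.Language.{0, 0} := ⟨Func σ, Rel σ⟩

variable {σ : Signature}

/-- The term `0`. -/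
def zeroT {α : Type} : (lang σ).Term α := Term.func (L := lang σ) Func.zero Fin.elim0

/-- The term `S t`. -/
def succT {α : Type} (t : (lang σ).Term α) : (lang σ).Term α :=
  Term.func (L := lang σ) Func.succ fun _ => t

/-- The numeral `S ... S 0` of a natural number. -/
def numeral {α : Type} : ℕ → (lang σ).Term α
  | 0 => zeroT
  | n + 1 => succT (numeral n)

/-! ### Formulas and proofs as strings, strings as numbers -/

/-- The finite alphabet. -/
inductive Symbol (σ : Signature)
  | newline | openBox | closeBox
  | bot | eq | imp | all
  | freeVar | boundVar | tally
  | zero | succ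
  | func (i : Fin σ.funs.length)
  | rel (i : Fin σ.rels.length)

/-- The digit of a symbol.  The digit `0` is left unused, as a blank, so that no string has a leading
zero and different strings are different numbers. -/
def Symbol.digit : Symbol σ → ℕ
  | newline => 1
  | openBox => 2
  | closeBox => 3
  | bot => 4
  | eq => 5
  | imp => 6
  | all => 7
  | freeVar => 8
  | boundVar => 9
  | tally => 10
  | zero => 11
  | succ => 12
  | func i => 13 + i
  | rel i => 13 + σ.funs.length + i

/-- The number of digits: the blank and the symbols. -/
def base (σ : Signature) : ℕ := 13 + σ.funs.length + σ.rels.length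

/-- The number that is written, in base `base σ`, by a string (first symbol leading). -/
def toNumber (w : List (Symbol σ)) : ℕ := Nat.ofDigits (base σ) (w.map Symbol.digit).reverse

/-- The length of a number: how many digits it has in base `base σ`. -/
def len (σ : Signature) (n : ℕ) : ℕ := (Nat.digits (base σ) n).length

theorem digit_pos (s : Symbol σ) : s.digit ≠ 0 := by
  cases s <;> simp [Symbol.digit]

theorem digit_lt (s : Symbol σ) : s.digit < base σ := by
  cases s <;> simp only [Symbol.digit, base] <;> omega

/-- The length of a string is the length of the number that it writes. -/
theorem len_toNumber (w : List (Symbol σ)) : len σ (toNumber w) = w.length := by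
  unfold len toNumber
  rw [Nat.digits_ofDigits]
  · simp
  · unfold base; omega
  · intro l hl
    simp only [List.mem_reverse, List.mem_map] at hl
    obtain ⟨s, -, rfl⟩ := hl
    exact digit_lt s
  · intro h
    have := List.getLast_mem h
    simp only [List.mem_reverse, List.mem_map] at this
    obtain ⟨s, -, hs⟩ := this
    rw [← hs]
    exact digit_pos s

/-- The symbol that a function symbol is written with. -/
def Func.symbol : {k : ℕ} → Func σ k → Symbol σ
  | _, .zero => .zero
  | _, .succ => .succ
  | _, .extra i => .func i

/-- The symbol that a relation symbol is written with. -/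
def Rel.symbol : {k : ℕ} → Rel σ k → Symbol σ
  | _, .extra i => .rel i

/-- Terms in Polish notation.  Variables are written as one of the two letters for free and for bound
variables, followed by their index in unary. -/
def termString {α : Type} (ix : α → ℕ) {n : ℕ} : (lang σ).Term (α ⊕ Fin n) → List (Symbol σ)
  | .var (.inl a) => .freeVar :: List.replicate (ix a) .tally
  | .var (.inr j) => .boundVar :: List.replicate j .tally
  | .func f ts => Func.symbol f :: (List.ofFn fun i => termString ix (ts i)).flatten

/-- Formulas in Polish notation.  The bound variable of a quantifier is determined by the number of
quantifiers around it, and is not written again next to the quantifier. -/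
def formulaString {α : Type} (ix : α → ℕ) {n : ℕ} :
    (lang σ).BoundedFormula α n → List (Symbol σ)
  | .falsum => [.bot]
  | .equal s t => .eq :: (termString ix s ++ termString ix t)
  | .rel R ts => Rel.symbol R :: (List.ofFn fun i => termString ix (ts i)).flatten
  | .imp φ ψ => .imp :: (formulaString ix φ ++ formulaString ix ψ)
  | .all φ => .all :: formulaString ix φ

/-- A sentence as a string. -/
def sentenceString (A : (lang σ).Sentence) : List (Symbol σ) := formulaString Empty.elim A

/-- A sentence as a number. -/
def code (A : (lang σ).Sentence) : ℕ := toNumber (sentenceString A)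

/-- A sentence, as a formula in which free variables could occur. -/
def toOpen (A : (lang σ).Sentence) : (lang σ).Formula ℕ := BoundedFormula.subst A Empty.elim

/-- An item of a (Fitch style) natural deduction proof: a line, or a sub-proof.  A sub-proof
consists of the variable that is arbitrary in it (if any), its hypothesis (if any), and its items. -/
inductive Item (σ : Signature)
  | line (φ : (lang σ).Formula ℕ)
  | box (a : Option ℕ) (h : Option ((lang σ).Formula ℕ)) (body : List (Item σ))

/-- An item as a string.  Every item in a list is ended by a new-line symbol. -/
def Item.string : Item σ → List (Symbol σ)
  | .line φ => formulaString id φ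
  | .box a h body =>
      .openBox :: (a.elim [] (fun i => .freeVar :: List.replicate i .tally) ++ .newline ::
        (h.elim [] (formulaString id) ++ .newline ::
          (body.flatMap (fun i => i.string ++ [.newline]) ++ [.closeBox])))

/-- A list of items as a number. -/
def proofCode (Γ : List (Item σ)) : ℕ :=
  toNumber (Γ.flatMap fun i => i.string ++ [.newline])

/-! ### Theories and representability -/

/-- A theory in the strict sense: a set of sentences that is closed under logical consequence. -/
def IsClosed (T : (lang σ).Theory) : Prop := ∀ A : (lang σ).Sentence, T ⊨ᵇ A → A ∈ T

/-- No sentence is a theorem together with its negation. -/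
def IsConsistent (T : (lang σ).Theory) : Prop :=
  ¬ ∃ A : (lang σ).Sentence, A ∈ T ∧ A.not ∈ T

/-- `∀ x, ¬ S x = 0`. -/
def axS0 : (lang σ).Sentence := ∀' (∼ (succT (&0) =' zeroT))

/-- `∀ x y, S x = S y → x = y`. -/
def axS1 : (lang σ).Sentence := ∀' ∀' ((succT (&0) =' succT (&1)) ⟹ ((&0) =' (&1)))

/-- `∀ x, x = 0 ∨ ∃ y, S y = x`. -/
def axS2 : (lang σ).Sentence := ∀' (((&0) =' zeroT) ⊔ ∃' (succT (&1) =' (&0)))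

/-- The formula `F(t₁, ..., t_m)`. -/
def applyTo {m n : ℕ} (F : (lang σ).Formula (Fin m)) (t : Fin m → (lang σ).Term (Empty ⊕ Fin n)) :
    (lang σ).BoundedFormula Empty n :=
  BoundedFormula.relabel (n := n) (k := 0) id (F.subst t)

/-- The sentence `(∃! y, F(x₁, ..., x_k, y)) ∧ F(x₁, ..., x_k, y)`, with the numerals of the given
numbers, where `∃! y, P(y)` is `∃ y, P(y) ∧ ∀ z, P(z) → z = y`. -/
def representsAt {k : ℕ} (F : (lang σ).Formula (Fin (k + 1))) (x : Fin k → ℕ) (y : ℕ) :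
    (lang σ).Sentence :=
  (∃' (applyTo F (Fin.snoc (fun i => numeral (x i)) (&0)) ⊓
    ∀' (applyTo F (Fin.snoc (fun i => numeral (x i)) (&1)) ⟹ ((&1) =' (&0))))) ⊓
  applyTo F (Fin.snoc (fun i => numeral (x i)) (numeral y))

/-- `T` contains the axioms of successorship and represents the partial function `f`. -/
def Represents (T : (lang σ).Theory) {k : ℕ} (f : (Fin k → ℕ) →. ℕ) : Prop :=
  axS0 ∈ T ∧ axS1 ∈ T ∧ axS2 ∈ T ∧
    ∃ F : (lang σ).Formula (Fin (k + 1)), ∀ x y, y ∈ f x → representsAt F x y ∈ T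

/-- `T` represents every (total) computable function. -/
def RepresentsComputable (T : (lang σ).Theory) : Prop :=
  ∀ (k : ℕ) (f : (Fin k → ℕ) → ℕ), Computable f → Represents T (f : (Fin k → ℕ) →. ℕ)

/-! ### Proof verifiers -/

/-- `V` is a proof verifier for `T`: a number is accepted, with some proof, exactly when it is a
theorem of `T`. -/
def IsVerifier (T : (lang σ).Theory) (V : ℕ → ℕ → Bool) : Prop :=
  ∀ a : ℕ, (∃ p, V p a = true) ↔ ∃ A ∈ T, code A = a

/-- There is a computable proof verifier for `T`. -/
def IsCE (T : (lang σ).Theory) : Prop := ∃ V : ℕ → ℕ → Bool, Computable₂ V ∧ IsVerifier T V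

/-- `φ(t)`, for a formula `φ(x)` with the distinguished variable `x`. -/
def inst (φ : (lang σ).BoundedFormula ℕ 1) (t : (lang σ).Term ℕ) : (lang σ).Formula ℕ :=
  BoundedFormula.subst φ.toFormula (Sum.elim Term.var fun _ => t)

/-- The equation `s = t`. -/
def eqn (s t : (lang σ).Term ℕ) : (lang σ).Formula ℕ := Term.equal s t

/-- `Follows Γ φ`: the formula `φ` follows from items of `Γ` by one application of a rule of natural
deduction for classical first-order logic with equality.  The rules for `¬` and `↔` are among those
for `→`, `∧` and `⊥`, as `¬ φ` is `φ → ⊥` and `φ ↔ ψ` is `(φ → ψ) ∧ (ψ → φ)`. -/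
inductive Follows (Γ : List (Item σ)) : (lang σ).Formula ℕ → Prop
  | repetition {φ} : .line φ ∈ Γ → Follows Γ φ
  | andIntro {φ ψ} : .line φ ∈ Γ → .line ψ ∈ Γ → Follows Γ (φ ⊓ ψ)
  | andLeft {φ ψ} : .line (φ ⊓ ψ) ∈ Γ → Follows Γ φ
  | andRight {φ ψ} : .line (φ ⊓ ψ) ∈ Γ → Follows Γ ψ
  | orLeft {φ ψ} : .line φ ∈ Γ → Follows Γ (φ ⊔ ψ)
  | orRight {φ ψ} : .line ψ ∈ Γ → Follows Γ (φ ⊔ ψ)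
  | orElim {φ ψ χ b c} : .line (φ ⊔ ψ) ∈ Γ → .box none (some φ) (b ++ [.line χ]) ∈ Γ →
      .box none (some ψ) (c ++ [.line χ]) ∈ Γ → Follows Γ χ
  | impIntro {φ ψ b} : .box none (some φ) (b ++ [.line ψ]) ∈ Γ → Follows Γ (φ.imp ψ)
  | impElim {φ ψ} : .line (φ.imp ψ) ∈ Γ → .line φ ∈ Γ → Follows Γ ψ
  | exFalso {φ} : .line ⊥ ∈ Γ → Follows Γ φ
  | doubleNeg {φ} : .line φ.not.not ∈ Γ → Follows Γ φ
  | allIntro {φ : (lang σ).BoundedFormula ℕ 1} {a b} : a ∉ φ.freeVarFinset →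
      .box (some a) none (b ++ [.line (inst φ (Term.var a))]) ∈ Γ → Follows Γ φ.all
  | allElim {φ : (lang σ).BoundedFormula ℕ 1} (t) : .line φ.all ∈ Γ → Follows Γ (inst φ t)
  | exIntro {φ : (lang σ).BoundedFormula ℕ 1} (t) : .line (inst φ t) ∈ Γ → Follows Γ φ.ex
  | exElim {φ : (lang σ).BoundedFormula ℕ 1} {χ : (lang σ).Formula ℕ} {a b} :
      a ∉ φ.freeVarFinset → a ∉ χ.freeVarFinset → .line φ.ex ∈ Γ →
      .box (some a) (some (inst φ (Term.var a))) (b ++ [.line χ]) ∈ Γ → Follows Γ χ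
  | eqRefl (t) : Follows Γ (eqn t t)
  | eqSubst {s t} {φ : (lang σ).BoundedFormula ℕ 1} : .line (eqn s t) ∈ Γ →
      .line (inst φ s) ∈ Γ → Follows Γ (inst φ t)

/-- `Valid T Δ i`: in the presence of the hypotheses `Δ`, the item `i` is correct over `T`.  A line
has to be a consequence of `T` and `Δ`.  In a sub-proof the arbitrary variable must not be free in
`Δ`, and all items must be correct when the hypothesis of the sub-proof is added. -/
inductive Valid (T : (lang σ).Theory) : List ((lang σ).Formula ℕ) → Item σ → Prop
  | line {Δ φ} : T ⊨ᵇ Δ.foldr BoundedFormula.imp φ → Valid T Δ (.line φ)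
  | box {Δ} {a : Option ℕ} {h : Option ((lang σ).Formula ℕ)} {body : List (Item σ)} :
      (∀ i ∈ a, ∀ δ ∈ Δ, i ∉ δ.freeVarFinset) →
      (∀ i ∈ body, Valid T (h.toList ++ Δ) i) → Valid T Δ (.box a h body)

/-- The items admitted at the top level of a proof: theorems of `T` and valid sub-proofs. -/
def Admissible (T : (lang σ).Theory) : Item σ → Prop
  | .line φ => ∃ A ∈ T, toOpen A = φ
  | .box a h body => Valid T [] (.box a h body)

/-- `V` is a canonical proof verifier for `T`: every proof `p` that it accepts for a sentence `A` is a
list of theorems of `T` and valid sub-proofs, with `A` among them, and whenever `B` follows from the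
items in `p` by a rule of inference, the list `p` extended by `B` is accepted as a proof of `B`.  (The
list `Γ` that is written by `p` is unique, since terms, formulas and items are uniquely readable.) -/
def IsCanonical (T : (lang σ).Theory) (V : ℕ → ℕ → Bool) : Prop :=
  IsVerifier T V ∧
    ∀ (p : ℕ) (A : (lang σ).Sentence), V p (code A) = true →
      (∃ Γ : List (Item σ), proofCode Γ = p) ∧
      ∀ Γ : List (Item σ), proofCode Γ = p →
        .line (toOpen A) ∈ Γ ∧ (∀ i ∈ Γ, Admissible T i) ∧
        ∀ B : (lang σ).Sentence, Follows Γ (toOpen B) →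
          V (proofCode (Γ ++ [.line (toOpen B)])) (code B) = true

/-! ### Proof complexity -/

/-- `p` is a proof of `A` or a proof of its negation. -/
def Decides (V : ℕ → ℕ → Bool) (p : ℕ) (A : (lang σ).Sentence) : Prop :=
  V p (code A) = true ∨ V p (code A.not) = true

/-- The minimal length of a number that decides `A`. -/
noncomputable def minLen (V : ℕ → ℕ → Bool) (A : (lang σ).Sentence) : ℕ :=
  sInf {l | ∃ p, Decides V p A ∧ len σ p = l}

/-- The proof complexity of a set of sentences: the maximum of `minLen V A` over its elements `A`
of length at most `n` (and `0` if there are none). -/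
noncomputable def complexity (V : ℕ → ℕ → Bool) (S : Set (lang σ).Sentence) (n : ℕ) : ℕ :=
  sSup {l | ∃ A ∈ S, len σ (code A) ≤ n ∧ minLen V A = l}

instance : Finite (Symbol σ) :=
  Finite.of_injective (fun s => (⟨s.digit, digit_lt s⟩ : Fin (base σ))) (by
    intro s t h
    have h' : s.digit = t.digit := congrArg Fin.val h
    cases s <;> cases t <;> simp only [Symbol.digit] at h' <;>
      first | rfl | omega | (congr 1; ext; omega))

/-- Only finitely many values are compared in the definition of `complexity`, so that the supremum
there is a maximum. -/
theorem complexity_finite (V : ℕ → ℕ → Bool) (S : Set (lang σ).Sentence) (n : ℕ) :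
    {l | ∃ A ∈ S, len σ (code A) ≤ n ∧ minLen V A = l}.Finite := by
  let F : List (Symbol σ) → ℕ := fun w =>
    sInf {l | ∃ p, (V p (toNumber w) = true ∨
      V p (toNumber (.imp :: (w ++ [.bot]))) = true) ∧ len σ p = l}
  refine ((List.finite_length_le (Symbol σ) n).image F).subset ?_
  rintro l ⟨A, -, hA, rfl⟩
  rw [code, len_toNumber] at hA
  exact ⟨sentenceString A, hA, rfl⟩

end ProofHierarchy

namespace ProofHierarchy
variable {σ : Signature}

/-! ### Strings and their lengths -/

/-! No computable function bounds minimal proof length in the length or code of the theorem: such a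
bound would make `T` decidable by searching all proofs below it, and a diagonal sentence refutes
that (`IsCanonical.exists_hard`).

Let `S` be all theorems whose minimal proof length is at most `C * g` of their length; its
complexity is `O(g)` by definition. For the lower bound, take one theorem `A` that is very hard for
its size and the least `m` with `minLen V A ≤ g m`, so that `g (m - 1) < minLen V A`. Conjoining `A`
with the trivial theorem `0 = 0 ∨ 0 = k` stretches it to length exactly `m`. By canonicity, proofs
of `A` and of `padded A k` convert into each other at linear cost (`IsCanonical.minLen_padded_le`,
`IsCanonical.minLen_le_padded`). So the padded sentence lies in `S` and its proof length exceeds `g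
(m - 1) / 2`, while a bound `O(f)` would make the complexity at `m` at most `g (m - 1) / 4`. -/

theorem one_lt_base (σ : Signature) : 1 < base σ := by unfold base; omega

theorem len_le_self (n : ℕ) : len σ n ≤ n :=
  (Nat.digits_length_le_iff (one_lt_base σ) n).2 (Nat.lt_pow_self (one_lt_base σ))

theorem lt_base_pow_len (n : ℕ) : n < base σ ^ len σ n :=
  Nat.lt_base_pow_length_digits (one_lt_base σ)

theorem toNumber_append (u v : List (Symbol σ)) :
    toNumber (u ++ v) = toNumber u * base σ ^ v.length + toNumber v := by
  simp only [toNumber, List.map_append, List.reverse_append, Nat.ofDigits_append,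
    List.length_reverse, List.length_map]
  ring

theorem termString_numeral {α : Type} (ix : α → ℕ) {m : ℕ} (n : ℕ) :
    termString (σ := σ) ix (numeral n : (lang σ).Term (α ⊕ Fin m)) =
      List.replicate n .succ ++ [.zero] := by
  induction n with
  | zero => simp [numeral, zeroT, termString, Func.symbol]
  | succ n ih => simp [numeral, succT, termString, Func.symbol, ih, List.replicate_succ]

theorem termString_subst_empty {n : ℕ} (t : (lang σ).Term (Empty ⊕ Fin n))
    (e : Empty → (lang σ).Term ℕ) (ix : ℕ → ℕ) :
    termString ix (t.subst (Sum.elim (Term.relabel Sum.inl ∘ e) (Term.var ∘ Sum.inr))) =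
      termString Empty.elim t := by
  induction t with
  | var a =>
    rcases a with a | j
    · exact a.elim
    · simp [Term.subst, termString]
  | func f ts ih => simp only [Term.subst, termString, ih]

theorem formulaString_subst_empty {n : ℕ} (φ : (lang σ).BoundedFormula Empty n)
    (e : Empty → (lang σ).Term ℕ) (ix : ℕ → ℕ) :
    formulaString ix (φ.subst e) = formulaString Empty.elim φ := by
  induction φ with
  | falsum => rfl
  | equal s t =>
    exact congrArg (Symbol.eq :: ·) (congrArg₂ (· ++ ·) (termString_subst_empty s e ix)
      (termString_subst_empty t e ix))
  | rel R ts =>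
    refine congrArg (Rel.symbol R :: ·) (congrArg List.flatten (congrArg List.ofFn ?_))
    exact funext fun i => termString_subst_empty (ts i) e ix
  | imp φ ψ hφ hψ => exact congrArg (Symbol.imp :: ·) (congrArg₂ (· ++ ·) hφ hψ)
  | all φ hφ => exact congrArg (Symbol.all :: ·) hφ

theorem len_code (A : (lang σ).Sentence) : len σ (code A) = (sentenceString A).length :=
  len_toNumber _

/-- A sentence keeps its string when opened, having no free variables to rename; the extra 1 is the
new-line symbol. -/
theorem len_proofCode_append_line (Γ : List (Item σ)) (A : (lang σ).Sentence) :
    len σ (proofCode (Γ ++ [.line (toOpen A)])) = len σ (proofCode Γ) + len σ (code A) + 1 := by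
  simp only [proofCode, len_toNumber, len_code, List.flatMap_append, List.length_append]
  simp [Item.string, toOpen, formulaString_subst_empty, sentenceString, add_assoc]

/-- `A ⊓ B` unfolds to `(A → (B → ⊥)) → ⊥`: three arrows and two `⊥`. -/
theorem len_code_inf (A B : (lang σ).Sentence) :
    len σ (code (A ⊓ B)) = len σ (code A) + len σ (code B) + 5 := by
  simp only [len_code]
  change (formulaString Empty.elim ((BoundedFormula.imp A B.not).not)).length = _
  simp [formulaString, sentenceString]
  omega

theorem len_code_sup (A B : (lang σ).Sentence) :
    len σ (code (A ⊔ B)) = len σ (code A) + len σ (code B) + 3 := by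
  simp only [len_code]
  change (formulaString Empty.elim (BoundedFormula.imp A.not B)).length = _
  simp [formulaString, sentenceString]
  omega

/-- The sentence `0 = n`. -/
def zeroEq (n : ℕ) : (lang σ).Sentence := BoundedFormula.equal (numeral 0) (numeral n)

theorem len_code_zeroEq (n : ℕ) : len σ (code (zeroEq (σ := σ) n)) = n + 3 := by
  simp [len_code, zeroEq, sentenceString, formulaString, termString_numeral]

/-! ### Canonical verifiers -/

theorem toOpen_inf (A B : (lang σ).Sentence) : toOpen (A ⊓ B) = toOpen A ⊓ toOpen B := rfl

theorem toOpen_sup (A B : (lang σ).Sentence) : toOpen (A ⊔ B) = toOpen A ⊔ toOpen B := rfl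

theorem toOpen_zeroEq_zero : toOpen (zeroEq (σ := σ) 0) = eqn zeroT zeroT := by
  refine congrArg₂ BoundedFormula.equal ?_ ?_ <;>
  · simp only [numeral, zeroT, Term.subst, Term.relabel]
    exact congrArg _ (funext fun i => i.elim0)

theorem realize_toOpen (A : (lang σ).Sentence) {M : Type*} [(lang σ).Structure M] (v : ℕ → M) :
    (toOpen A).Realize v ↔ M ⊨ A := by
  unfold toOpen Formula.Realize Sentence.Realize Formula.Realize
  rw [BoundedFormula.realize_subst]
  exact iff_of_eq (congrArg (fun w => BoundedFormula.Realize A w _) (Subsingleton.elim _ _))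

/-- Injectivity of `toOpen` is not needed: sentences with the same opening hold in the same models,
and `T` is closed under consequence. -/
theorem mem_of_toOpen_eq {T : (lang σ).Theory} (hT : IsClosed T) {A C : (lang σ).Sentence}
    (hC : C ∈ T) (h : toOpen C = toOpen A) : A ∈ T := by
  refine hT A (Theory.models_sentence_iff.2 fun M => ?_)
  have hM : (M : Type _) ⊨ C := Theory.realize_sentence_of_mem T hC
  let v : ℕ → M := fun _ => Classical.arbitrary M
  rw [← realize_toOpen A v, ← h, realize_toOpen C v]
  exact hM

variable {T : (lang σ).Theory} {V : ℕ → ℕ → Bool}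

/-- `IsVerifier` alone only gives a theorem with the same code as `A`. Going through the lines of
the proof avoids showing that `code` is injective. -/
theorem IsCanonical.mem (hcan : IsCanonical T V) (hT : IsClosed T) {p : ℕ}
    {A : (lang σ).Sentence} (h : V p (code A) = true) : A ∈ T := by
  obtain ⟨⟨Γ, hΓ⟩, h⟩ := hcan.2 p A h
  obtain ⟨hA, had, -⟩ := h Γ hΓ
  obtain ⟨C, hC, hCA⟩ := had _ hA
  exact mem_of_toOpen_eq hT hC hCA

theorem IsCanonical.line_mem (hcan : IsCanonical T V) {Γ : List (Item σ)}
    {A : (lang σ).Sentence} (h : V (proofCode Γ) (code A) = true) : .line (toOpen A) ∈ Γ :=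
  ((hcan.2 _ A h).2 Γ rfl).1

theorem IsCanonical.extend (hcan : IsCanonical T V) {Γ : List (Item σ)}
    {A B : (lang σ).Sentence} (h : V (proofCode Γ) (code A) = true)
    (hB : Follows Γ (toOpen B)) : V (proofCode (Γ ++ [.line (toOpen B)])) (code B) = true :=
  ((hcan.2 _ A h).2 Γ rfl).2.2 B hB

/-! ### Minimal proof lengths -/

theorem minLen_le {p : ℕ} {A : (lang σ).Sentence} (h : V p (code A) = true) :
    minLen V A ≤ len σ p :=
  Nat.sInf_le ⟨p, Or.inl h, rfl⟩

theorem IsCanonical.exists_minimal_proof (hcan : IsCanonical T V) (hT : IsClosed T)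
    (hcons : IsConsistent T) {A : (lang σ).Sentence} (hA : A ∈ T) :
    ∃ Γ : List (Item σ), V (proofCode Γ) (code A) = true ∧
      len σ (proofCode Γ) = minLen V A := by
  obtain ⟨q, hq⟩ := (hcan.1 (code A)).2 ⟨A, hA, rfl⟩
  obtain ⟨p, hp, hlen⟩ : minLen V A ∈ {l | ∃ p, Decides V p A ∧ len σ p = l} :=
    Nat.sInf_mem ⟨_, q, Or.inl hq, rfl⟩
  rcases hp with hp | hp
  · obtain ⟨Γ, rfl⟩ := (hcan.2 p A hp).1
    exact ⟨Γ, hp, hlen⟩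
  -- `minLen` also counts refutations; consistency excludes them for a theorem.
  · exact absurd ⟨A, hA, hcan.mem hT hp⟩ hcons

/-- The conjunction of `A` with the theorem `0 = 0 ∨ 0 = k`. -/
def padded (A : (lang σ).Sentence) (k : ℕ) : (lang σ).Sentence := A ⊓ (zeroEq 0 ⊔ zeroEq k)

theorem len_code_padded (A : (lang σ).Sentence) (k : ℕ) :
    len σ (code (padded A k)) = len σ (code A) + k + 14 := by
  simp only [padded, len_code_inf, len_code_sup, len_code_zeroEq]
  omega

/-- A shortest proof of `A` is extended by three lines: `0 = 0`, then `0 = 0 ∨ 0 = k`, then the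
conjunction. -/
theorem IsCanonical.exists_proof_padded (hcan : IsCanonical T V) (hT : IsClosed T)
    (hcons : IsConsistent T) {A : (lang σ).Sentence} (hA : A ∈ T) (k : ℕ) :
    ∃ p, V p (code (padded A k)) = true ∧
      len σ p = minLen V A + len σ (code A) + 2 * k + 29 := by
  obtain ⟨Γ, hΓ, hlen⟩ := hcan.exists_minimal_proof hT hcons hA
  have h₁ := hcan.extend (B := zeroEq 0) hΓ (toOpen_zeroEq_zero ▸ Follows.eqRefl zeroT)
  have h₂ := hcan.extend (B := zeroEq 0 ⊔ zeroEq k) h₁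
    (Follows.orLeft (ψ := toOpen (zeroEq k)) (hcan.line_mem h₁))
  have h₃ := hcan.extend (B := padded A k) h₂
    (Follows.andIntro (List.mem_append_left _ (List.mem_append_left _ (hcan.line_mem hΓ))) (hcan.line_mem h₂))
  refine ⟨_, h₃, ?_⟩
  simp only [len_proofCode_append_line, len_code_padded, len_code_sup, len_code_zeroEq]
  omega

theorem IsCanonical.padded_mem (hcan : IsCanonical T V) (hT : IsClosed T)
    (hcons : IsConsistent T) {A : (lang σ).Sentence} (hA : A ∈ T) (k : ℕ) : padded A k ∈ T :=
  have ⟨_, hp, _⟩ := hcan.exists_proof_padded hT hcons hA k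
  hcan.mem hT hp

theorem IsCanonical.minLen_padded_le (hcan : IsCanonical T V) (hT : IsClosed T)
    (hcons : IsConsistent T) {A : (lang σ).Sentence} (hA : A ∈ T) (k : ℕ) :
    minLen V (padded A k) ≤ minLen V A + len σ (code A) + 2 * k + 29 :=
  have ⟨_, hp, hlen⟩ := hcan.exists_proof_padded hT hcons hA k
  hlen ▸ minLen_le hp

theorem IsCanonical.minLen_le_padded (hcan : IsCanonical T V) (hT : IsClosed T)
    (hcons : IsConsistent T) {A : (lang σ).Sentence} (hA : A ∈ T) (k : ℕ) :
    minLen V A ≤ minLen V (padded A k) + len σ (code A) + 1 := by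
  obtain ⟨Γ, hΓ, hlen⟩ := hcan.exists_minimal_proof hT hcons (hcan.padded_mem hT hcons hA k)
  have h := hcan.extend (B := A) hΓ
    (Follows.andLeft (ψ := toOpen (zeroEq 0 ⊔ zeroEq k)) (hcan.line_mem hΓ))
  exact (minLen_le h).trans (by rw [len_proofCode_append_line, hlen])

theorem minLen_le_complexity {S : Set (lang σ).Sentence} {A : (lang σ).Sentence} (hA : A ∈ S)
    {n : ℕ} (hn : len σ (code A) ≤ n) : minLen V A ≤ complexity V S n :=
  le_csSup (complexity_finite V S n).bddAbove ⟨A, hA, hn, rfl⟩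

theorem complexity_le {S : Set (lang σ).Sentence} {n b : ℕ}
    (h : ∀ A ∈ S, len σ (code A) ≤ n → minLen V A ≤ b) : complexity V S n ≤ b :=
  csSup_le' (by rintro _ ⟨A, hA, hn, rfl⟩; exact h A hA hn)

/-! ### Undecidability -/

section Semantics

variable {M : Type*} [(lang σ).Structure M]

theorem realize_numeral {α β : Type} (n : ℕ) (v : α → M) (w : β → M) :
    (numeral n : (lang σ).Term α).realize v = (numeral n : (lang σ).Term β).realize w := by
  induction n with
  | zero => exact congrArg (Structure.funMap _) (funext fun i => i.elim0)
  | succ n ih => exact congrArg (Structure.funMap _) (funext fun _ => ih)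

theorem realize_applyTo {m n : ℕ} (F : (lang σ).Formula (Fin m))
    (t : Fin m → (lang σ).Term (Empty ⊕ Fin n)) (v : Empty → M) (xs : Fin n → M) :
    (applyTo F t).Realize v xs ↔ F.Realize fun i => (t i).realize (Sum.elim v xs) := by
  unfold applyTo Formula.Realize
  refine BoundedFormula.realize_relabel.trans (BoundedFormula.realize_subst.trans ?_)
  exact iff_of_eq (congrArg₂ (fun a b => BoundedFormula.Realize F a b) rfl (Subsingleton.elim _ _))

/-- The sentence `∀ x, F(x, 1) → ¬ x = n`. -/
def notApply (F : (lang σ).Formula (Fin 2)) (n : ℕ) : (lang σ).Sentence :=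
  BoundedFormula.all (BoundedFormula.imp (applyTo F (Fin.snoc (fun _ => &0) (numeral 1)))
    (BoundedFormula.imp (BoundedFormula.equal (&0) (numeral n)) BoundedFormula.falsum))

/-- The value of a numeral in a structure. -/
def numVal (σ : Signature) (M : Type*) [(lang σ).Structure M] (n : ℕ) : M :=
  (numeral n : (lang σ).Term Empty).realize Empty.elim

theorem realize_numeral_eq {α : Type} (n : ℕ) (v : α → M) :
    (numeral n : (lang σ).Term α).realize v = numVal σ M n := realize_numeral n _ _

theorem realize_notApply (F : (lang σ).Formula (Fin 2)) (n : ℕ) :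
    M ⊨ notApply F n ↔ ¬ F.Realize ![numVal σ M n, numVal σ M 1] := by
  have key (a : M) : (fun i => ((Fin.snoc (fun _ => &0) (numeral 1) :
      Fin 2 → (lang σ).Term (Empty ⊕ Fin 1)) i).realize (Sum.elim default (Fin.snoc default a)))
      = ![a, numVal σ M 1] := by
    funext i
    refine Fin.cases ?_ (fun i => ?_) i
    · rfl
    · rw [Subsingleton.elim i 0]
      exact realize_numeral_eq 1 _
  have h : M ⊨ notApply F n ↔ ∀ a : M, F.Realize ![a, numVal σ M 1] → ¬ a = numVal σ M n := by
    refine forall_congr' fun a => imp_congr ?_ (not_congr ?_)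
    · rw [realize_applyTo, key]
    · exact iff_of_eq (congrArg₂ Eq rfl (realize_numeral_eq n _))
  rw [h]
  exact ⟨fun h h' => h _ h' rfl, fun h a h' ha => h (ha ▸ h')⟩

theorem realize_representsAt {F : (lang σ).Formula (Fin 2)} {x : Fin 1 → ℕ} {y : ℕ}
    (h : M ⊨ representsAt F x y) :
    F.Realize ![numVal σ M (x 0), numVal σ M y] ∧
      ∀ b : M, F.Realize ![numVal σ M (x 0), b] → b = numVal σ M y := by
  have key {m : ℕ} (t : (lang σ).Term (Empty ⊕ Fin m)) (xs : Fin m → M) :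
      (fun i => ((Fin.snoc (fun i => numeral (x i)) t :
        Fin 2 → (lang σ).Term (Empty ⊕ Fin m)) i).realize (Sum.elim default xs))
      = ![numVal σ M (x 0), t.realize (Sum.elim default xs)] := by
    funext i
    refine Fin.cases ?_ (fun i => ?_) i
    · exact realize_numeral_eq (x 0) _
    · rw [Subsingleton.elim i 0]
      rfl
  unfold representsAt Sentence.Realize Formula.Realize at h
  simp only [BoundedFormula.realize_inf, BoundedFormula.realize_ex, BoundedFormula.realize_all,
    BoundedFormula.realize_imp, realize_applyTo, key, BoundedFormula.realize_bdEqual] at h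
  obtain ⟨⟨a, -, ha⟩, hy⟩ := h
  rw [realize_numeral_eq] at hy
  have ha' (b : M) (hb : F.Realize ![numVal σ M (x 0), b]) : b = a := ha b hb
  exact ⟨hy, fun b hb => (ha' b hb).trans (ha' _ hy).symm⟩

theorem numVal_one_ne_zero (h : M ⊨ (axS0 : (lang σ).Sentence)) :
    numVal σ M 1 ≠ numVal σ M 0 := by
  have h' : ∀ a : M, ¬ _ := h
  intro h1
  refine h' (numVal σ M 0) (Eq.trans ?_ (h1.trans ?_))
  · exact congrArg (Structure.funMap _) (funext fun _ => rfl)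
  · exact (realize_numeral_eq 0 _).symm

end Semantics

/-- The number of the string `w ++ "→ = x S ⋯ S 0 ⊥"` (with `n` letters `S`), for the string `w` of
number `n`. -/
def diagonal (σ : Signature) (n : ℕ) : ℕ :=
  -- The exponents count the symbols still to follow; the bound variable of index 0 is a single
  -- letter without tallies.
  n * base σ ^ (n + 5) + (toNumber ([.imp, .eq, .boundVar] : List (Symbol σ)) * base σ ^ (n + 2) +
    (toNumber (List.replicate n (Symbol.succ : Symbol σ)) * base σ ^ 2 +
      toNumber ([.zero, .bot] : List (Symbol σ))))

/-- The number of the string that `notApply F` has before its numeral. -/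
def prefixCode (F : (lang σ).Formula (Fin 2)) : ℕ :=
  toNumber (.all :: .imp :: formulaString Empty.elim
    (applyTo (n := 1) F (Fin.snoc (fun _ => &0) (numeral 1))))

/-- The fixed point. Since the numeral occurs once, near the end of `notApply F n`, self-reference
needs only string concatenation: the numeral names the part of the sentence written before it. -/
theorem code_notApply (F : (lang σ).Formula (Fin 2)) :
    code (notApply F (prefixCode F)) = diagonal σ (prefixCode F) := by
  have h (n : ℕ) : sentenceString (notApply F n) =
      (.all :: .imp :: formulaString Empty.elim
        (applyTo (n := 1) F (Fin.snoc (fun _ => &0) (numeral 1)))) ++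
      ([.imp, .eq, .boundVar] ++ (List.replicate n .succ ++ [.zero, .bot])) := by
    change Symbol.all :: Symbol.imp :: (_ ++ Symbol.imp :: ((Symbol.eq ::
      ([Symbol.boundVar] ++ termString _ (numeral n))) ++ [Symbol.bot])) = _
    rw [termString_numeral]
    simp
  rw [code, h, toNumber_append, toNumber_append, toNumber_append]
  simp [diagonal, prefixCode, add_assoc]

/-! ### Computability of the diagonal function and of bounded proof search -/

theorem primrec_pow (b : ℕ) : Primrec fun n : ℕ => b ^ n :=
  (Primrec.nat_rec₁ 1 (f := fun _ y => y * b)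
    (Primrec.nat_mul.comp Primrec.snd (Primrec.const b))).of_eq fun n => by
    induction n with
    | zero => rfl
    | succ n ih => simp only [pow_succ, ← ih]

theorem toNumber_replicate_succ (a : Symbol σ) (n : ℕ) :
    toNumber (List.replicate (n + 1) a) =
      toNumber (List.replicate n a) * base σ + toNumber [a] := by
  rw [List.replicate_succ', toNumber_append]
  simp

theorem primrec_toNumber_replicate (a : Symbol σ) :
    Primrec fun n : ℕ => toNumber (List.replicate n a) :=
  (Primrec.nat_rec₁ 0 (f := fun _ y => y * base σ + toNumber [a]) (Primrec.nat_add.comp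
    (Primrec.nat_mul.comp Primrec.snd (Primrec.const (base σ)))
      (Primrec.const (toNumber [a])))).of_eq fun n => by
    induction n with
    | zero => rfl
    | succ n ih => rw [toNumber_replicate_succ, ← ih]

theorem primrec_diagonal (σ : Signature) : Primrec (diagonal σ) := by
  have hp (k : ℕ) : Primrec fun n : ℕ => base σ ^ (n + k) :=
    (primrec_pow _).comp (Primrec.nat_add.comp Primrec.id (Primrec.const k))
  have add {u v : ℕ → ℕ} (hu : Primrec u) (hv : Primrec v) : Primrec fun n => u n + v n :=
    Primrec.nat_add.comp hu hv
  have mul {u v : ℕ → ℕ} (hu : Primrec u) (hv : Primrec v) : Primrec fun n => u n * v n :=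
    Primrec.nat_mul.comp hu hv
  exact add (mul Primrec.id (hp 5)) (add (mul (Primrec.const _) (hp 2))
    (add (mul (primrec_toNumber_replicate _) (Primrec.const _)) (Primrec.const _)))

theorem computable_exists_lt {V : ℕ → ℕ → Bool} (hV : Computable₂ V) :
    Computable₂ fun a b : ℕ => decide (∃ p < b, V p a = true) := by
  have h : Computable fun x : ℕ × ℕ => (Nat.rec false (fun p r => r || V p x.1) x.2 : Bool) :=
    Computable.nat_rec (f := Prod.snd) (g := fun _ => false)
      (h := fun x y => y.2 || V y.1 x.1) Computable.snd (Computable.const false)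
      (Primrec.or.to_comp.comp (Computable.snd.comp Computable.snd)
        (hV.comp (Computable.fst.comp Computable.snd) (Computable.fst.comp Computable.fst)))
  refine h.of_eq fun ⟨a, b⟩ => ?_
  induction b with
  | zero => simp
  | succ b ih =>
    simp only at ih ⊢
    rw [ih, Bool.eq_iff_iff]
    simp only [Bool.or_eq_true, decide_eq_true_eq]
    constructor
    · rintro (⟨p, hp, h⟩ | h)
      · exact ⟨p, by omega, h⟩
      · exact ⟨b, by omega, h⟩
    · rintro ⟨p, hp, h⟩
      rcases Nat.lt_succ_iff_lt_or_eq.1 hp with hp | rfl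
      · exact Or.inl ⟨p, hp, h⟩
      · exact Or.inr h

/-- Proof lengths in a consistent theory that represents the computable functions have no
computable bound. -/
theorem IsCanonical.exists_hard {T : (lang σ).Theory} {V : ℕ → ℕ → Bool}
    (hcan : IsCanonical T V) (hV : Computable₂ V) (hT : IsClosed T) (hcons : IsConsistent T)
    (hrep : RepresentsComputable T) {h : ℕ → ℕ} (hh : Computable h) :
    ∃ A ∈ T, h (code A) < minLen V A := by
  by_contra! hcon
  -- A number with at most `h a` digits is below `base σ ^ h a`, so under `hcon` this search decides
  -- `T` on codes of sentences.
  let d (a : ℕ) : Bool := decide (∃ p < base σ ^ h a, V p a = true)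
  have hd : Computable d :=
    (computable_exists_lt hV).comp Computable.id ((primrec_pow _).to_comp.comp hh)
  have hdT (A : (lang σ).Sentence) : d (code A) = true ↔ A ∈ T := by
    simp only [d, decide_eq_true_eq]
    constructor
    · rintro ⟨p, -, hp⟩
      exact hcan.mem hT hp
    · intro hA
      obtain ⟨Γ, hΓ, hlen⟩ := hcan.exists_minimal_proof hT hcons hA
      refine ⟨_, (lt_base_pow_len (σ := σ) _).trans_le ?_, hΓ⟩
      exact Nat.pow_le_pow_right (one_lt_base σ).le (hlen ▸ hcon A hA)
  have happ : Computable fun x : Fin 1 → ℕ => x 0 :=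
    (Primrec.fin_app.comp Primrec.id (Primrec.const 0)).to_comp
  have hδ : Computable fun x : Fin 1 → ℕ => bif d (diagonal σ (x 0)) then 1 else 0 :=
    Computable.cond (hd.comp ((primrec_diagonal σ).to_comp.comp happ)) (Computable.const 1)
      (Computable.const 0)
  -- With `F` representing this function, `notApply F (prefixCode F)` says of itself that `d`
  -- rejects it.
  obtain ⟨h0, -, -, F, hF⟩ := hrep 1 _ hδ
  have hFn := hF (fun _ => prefixCode F) _ (Part.mem_some _)
  beta_reduce at hFn
  rw [← code_notApply F] at hFn
  cases hG : d (code (notApply F (prefixCode F))) with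
  | true =>
    rw [hG] at hFn
    -- `T` contains both `F(n, 1)` and a sentence denying it, so it has no model and contains
    -- everything.
    have hno (B : (lang σ).Sentence) : B ∈ T := by
      refine hT B (Theory.models_sentence_iff.2 fun M => ?_)
      have h₁ := realize_representsAt (M := M) (Theory.realize_sentence_of_mem T hFn)
      have h₂ := (realize_notApply (M := M) F _).1
        (Theory.realize_sentence_of_mem T ((hdT _).1 hG))
      exact absurd h₁.1 h₂
    exact hcons ⟨⊥, hno _, hno _⟩
  | false =>
    rw [hG] at hFn
    -- The value represented is 0; uniqueness and `1 ≠ 0` exclude `F(n, 1)`, so the sentence is a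
    -- theorem after all and `d` accepts it.
    refine Bool.false_ne_true (hG.symm.trans ((hdT _).2 (hT _ ?_)))
    refine Theory.models_sentence_iff.2 fun M => (realize_notApply (M := M) F _).2 fun h₁ => ?_
    exact numVal_one_ne_zero (Theory.realize_sentence_of_mem T h0)
      ((realize_representsAt (M := M) (Theory.realize_sentence_of_mem T hFn)).2 _ h₁)

end ProofHierarchy

/-! ### The hierarchy theorem -/

open ProofHierarchy in
theorem mainTheorem9 (σ : ProofHierarchy.Signature) (T : (ProofHierarchy.lang σ).Theory)
    (hT : ProofHierarchy.IsClosed T) (hcons : ProofHierarchy.IsConsistent T)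
    (hce : ProofHierarchy.IsCE T) (hrep : ProofHierarchy.RepresentsComputable T)
    (g : ℕ → ℕ) (hg : Computable g) (hmono : Monotone g)
    (hlin : (fun n : ℕ => (n : ℝ)) =O[atTop] (fun n : ℕ => (g n : ℝ)))
    (f : ℕ → ℝ) (hf : (fun n : ℕ => f (n + 1)) =o[atTop] (fun n : ℕ => (g n : ℝ)))
    (V : ℕ → ℕ → Bool) (hV : Computable₂ V) (hcan : ProofHierarchy.IsCanonical T V) :
    ∃ S : Set (ProofHierarchy.lang σ).Sentence, S ⊆ T ∧
      (fun n : ℕ => (ProofHierarchy.complexity V S n : ℝ)) =O[atTop] (fun n : ℕ => (g n : ℝ)) ∧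
      ¬ (fun n : ℕ => (ProofHierarchy.complexity V S n : ℝ)) =O[atTop] f := by
  obtain ⟨L, hL⟩ := hlin.bound
  obtain ⟨N₀, hN₀⟩ := eventually_atTop.1 hL
  obtain ⟨K, hLK⟩ := exists_nat_ge L
  have hK (n : ℕ) (hn : N₀ ≤ n) : n ≤ K * g n := by
    have h := hN₀ n hn
    rw [Real.norm_natCast, Real.norm_natCast] at h
    exact_mod_cast h.trans (mul_le_mul_of_nonneg_right hLK (Nat.cast_nonneg _))
  -- Generous: the padded sentence of length `m` will need at most `g m + 2 * m + 1`, and `m ≤ K * g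
  -- m`.
  let C := 30 * K + 30
  let S : Set (lang σ).Sentence := {A | A ∈ T ∧ minLen V A ≤ C * g (len σ (code A))}
  refine ⟨S, fun A hA => hA.1, ?_, fun hO => ?_⟩
  · refine IsBigO.of_bound C (Eventually.of_forall fun n => ?_)
    rw [Real.norm_natCast, Real.norm_natCast]
    have h : complexity V S n ≤ C * g n :=
      complexity_le fun A hA hn => hA.2.trans (Nat.mul_le_mul_left _ (hmono hn))
    exact_mod_cast h
  obtain ⟨D, hDpos, hD⟩ := hO.exists_pos
  obtain ⟨N₁, hN₁⟩ := eventually_atTop.1 hD.bound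
  obtain ⟨N₂, hN₂⟩ := eventually_atTop.1 (hf.def (show (0 : ℝ) < 1 / (4 * D) by positivity))
  let N := N₀ + N₁ + N₂ + 1
  -- One hard theorem past all thresholds suffices. The term `g (a + 14)` leaves room for padding,
  -- whose overhead is 14 symbols; `2 * a + 2` makes the cost of recovering `A` less than half of
  -- `minLen V A`; `g N` pushes `m` beyond `N`.
  obtain ⟨A, hA, hhard⟩ := hcan.exists_hard hV hT hcons hrep
    (h := fun a => g (a + 14) + (2 * a + 2 + g N))
    (Primrec.nat_add.to_comp.comp
      (hg.comp (Primrec.nat_add.comp Primrec.id (Primrec.const 14)).to_comp)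
      (Primrec.nat_add.comp (Primrec.nat_add.comp
        (Primrec.nat_mul.comp (Primrec.const 2) Primrec.id) (Primrec.const 2))
        (Primrec.const (g N))).to_comp)
  have hlen := len_le_self (σ := σ) (code A)
  -- Linear growth makes `g` unbounded.
  have hunb : ∃ m, minLen V A ≤ g m := by
    by_contra! hlt
    have h₁ := hK (N₀ + (K * minLen V A + 1)) (by omega)
    have h₂ := Nat.mul_le_mul_left K (hlt (N₀ + (K * minLen V A + 1))).le
    omega
  let m := Nat.find hunb
  have hm : minLen V A ≤ g m := Nat.find_spec hunb
  have hlt_of {k : ℕ} (hk : g k < minLen V A) : k < m := by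
    by_contra! hle
    exact absurd (hmono hle) (by omega)
  have hmN : N < m := hlt_of (by omega)
  have hmA : len σ (code A) + 14 < m :=
    hlt_of ((hmono (Nat.add_le_add_right hlen 14)).trans_lt (by omega))
  have hpred : g (m - 1) < minLen V A := not_le.1 (Nat.find_min hunb (by omega : m - 1 < m))
  obtain ⟨k, hk⟩ := Nat.exists_eq_add_of_le hmA.le
  have hlenP : len σ (code (padded A k)) = m := by rw [len_code_padded]; omega
  have hupper := hcan.minLen_padded_le hT hcons hA k
  have hlower := hcan.minLen_le_padded hT hcons hA k
  have hPS : padded A k ∈ S := by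
    refine ⟨hcan.padded_mem hT hcons hA k, ?_⟩
    rw [hlenP]
    have h₁ := hK m (by omega)
    have h₂ : C * g m = 30 * (K * g m) + 30 * g m := by ring
    omega
  have hcx : minLen V A ≤ 2 * complexity V S m := by
    have := minLen_le_complexity (V := V) hPS hlenP.le
    omega
  have hm₁ := hN₁ m (by omega)
  -- The shift in `f (n + 1) = o(g n)` is used here: it compares `f m` with `g (m - 1)`, the value
  -- just below `minLen V A`.
  have hm₂ := hN₂ (m - 1) (by omega)
  rw [Nat.sub_add_cancel (by omega), Real.norm_natCast] at hm₂
  rw [Real.norm_natCast] at hm₁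
  have h₃ : (complexity V S m : ℝ) ≤ g (m - 1) / 4 :=
    calc (complexity V S m : ℝ) ≤ D * (1 / (4 * D) * g (m - 1)) :=
          hm₁.trans (mul_le_mul_of_nonneg_left hm₂ hDpos.le)
      _ = g (m - 1) / 4 := by field_simp
  have h₄ : (g (m - 1) : ℝ) < minLen V A := by exact_mod_cast hpred
  have h₅ : (minLen V A : ℝ) ≤ 2 * complexity V S m := by exact_mod_cast hcx
  have h₆ : (0 : ℝ) ≤ g (m - 1) := Nat.cast_nonneg _
  linarith
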